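/- Let $(\mu_k)_{k\ge 1}$ be a sequence of real numbers, and let $\Delta$ denote the forward difference operator, $\Delta\mu_k=\mu_{k+1}-\mu_k$, $\Delta^{s+1}=\Delta\Delta^s$. There exists an integrable, non-degenerate (i.e. not almost surely constant) real random variable $X$ such that, for every $k\ge 1$, $$\mu_k=\mathbb{E}\max\{X_1,\dots,X_k\},\qquad X_1,\dots,X_k \text{ independent copies of } X,$$ if and only if the following three conditions are satisfied: (i) $(-1)^{s+1}\Delta^s\mu_k>0$ for all $s\ge 1$ and $k\ge 1$; (ii) $\mu_k=o(k)$ as $k\to\infty$; (iii) $\sum_{j=1}^k(-1)^j\binom{k}{j}\mu_j=o(k)$ as $k\to\infty$. -/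

import Mathlib

open MeasureTheory

universe u

/-- The expectation `E X_{k:k}` of the maximum of `k ≥ 1` independent copies of the random variable
`X : Ω → ℝ`. The copies are the functions `ω ↦ X (ω i)`, `i : Fin k`, on the `k`-fold product of
the probability space `(Ω, P)` with itself. -/
noncomputable def expectedMax {Ω : Type*} [MeasurableSpace Ω] (P : Measure Ω) (X : Ω → ℝ)
    (k : ℕ) : ℝ :=
  ∫ ω : Fin k → Ω, (⨆ i : Fin k, X (ω i)) ∂(Measure.pi fun _ : Fin k => P)

/-- A random variable is degenerate if it is almost surely equal to a constant. -/
def IsDegenerate {Ω : Type*} [MeasurableSpace Ω] (P : Measure Ω) (X : Ω → ℝ) : Prop :=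
  ∃ c : ℝ, ∀ᵐ ω ∂P, X ω = c

open Filter Topology Polynomial

/-! Let `F` be the distribution function of `X`. Writing a number as the integral of the signed
indicator `layer` gives `E max = ∫ (1_{w ≥ 0} - F ^ k) dw`, hence `(-1)^(s+1) Δ^s μ_k = ∫ F ^ k (1 -
F) ^ s dw` for `s, k ≥ 1`. This is positive because `F` lies strictly between 0 and 1 on some
interval. Both growth conditions follow by dominated convergence, applied to `F` and to `1 - F`
(`isLittleO_integral_sub_pow`).

Conversely, (i) makes the increments of `μ` completely monotone, so they are the moments of a
measure on `[0, 1]`; (ii) and (iii) exclude atoms at 1 and 0 (`exists_measure_Ioo_moments`).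
Dividing this measure by `w (1 - w)` gives `l`. With `U` uniform, take `X = G(U) + d`, where `G(u)`
is the signed `l`-mass between `1/2` and `u`. Then the increments of `E max` are `∫ (w ^ k - w ^
(k+1)) dl`, the prescribed moments. The formula `expectedMax_integral_layer` serves both directions,
with Lebesgue measure and with `l`. -/

theorem fwdDiff_iterate_succ_apply (f : ℕ → ℝ) (s k : ℕ) :
    (fwdDiff 1)^[s + 1] f k = (fwdDiff 1)^[s] f (k + 1) - (fwdDiff 1)^[s] f k := by
  rw [Function.iterate_succ_apply', fwdDiff]

theorem fwdDiff_iterate_fwdDiff_shift (f : ℕ → ℝ) (s k : ℕ) :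
    (fwdDiff 1)^[s] (fun j => fwdDiff 1 f (j + 1)) k = (fwdDiff 1)^[s + 1] f (k + 1) := by
  induction s generalizing k with
  | zero => rfl
  | succ s ih => rw [fwdDiff_iterate_succ_apply, ih, ih, fwdDiff_iterate_succ_apply f (s + 1)]

/-- The alternating iterated differences of `a` are determined by their recursion. -/
theorem neg_one_pow_mul_fwdDiff_iterate_eq {a : ℕ → ℝ} {c : ℕ → ℕ → ℝ} (h0 : ∀ k, c 0 k = a k)
    (hs : ∀ s k, c (s + 1) k = c s k - c s (k + 1)) (s k : ℕ) :
    (-1 : ℝ) ^ s * (fwdDiff 1)^[s] a k = c s k := by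
  induction s generalizing k with
  | zero => simp [h0]
  | succ s ih => rw [hs, ← ih, ← ih, fwdDiff_iterate_succ_apply]; ring

/-! ### The Hausdorff moment problem. -/

/-- These are the factorial moments of the binomial weights, obtained by absorbing one factor of `k`
into the binomial coefficient at a time. The general ring allows `x = X`, `y = 1 - X` in `ℝ[X]`. -/
theorem sum_choose_mul_descFactorial {R : Type*} [CommSemiring R] (x y : R) (j n : ℕ) :
    ∑ k ∈ Finset.range (n + 1), (n.choose k : R) * k.descFactorial j * (x ^ k * y ^ (n - k)) =
      n.descFactorial j * x ^ j * (x + y) ^ (n - j) := by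
  induction j generalizing n with
  | zero =>
    rw [add_pow]
    simp only [Nat.descFactorial_zero, Nat.cast_one, mul_one, pow_zero, one_mul, Nat.sub_zero]
    exact Finset.sum_congr rfl fun k _ => by ring
  | succ j ih =>
    cases n with
    | zero => simp
    | succ n =>
      rw [Finset.sum_range_succ', Nat.succ_descFactorial_succ, Nat.add_sub_add_right]
      have h := congrArg (fun z => ((n + 1 : ℕ) : R) * x * z) (ih n)
      simp only [Finset.mul_sum] at h
      simp only [Nat.zero_descFactorial_succ, Nat.cast_zero, mul_zero, zero_mul, add_zero]
      refine (Finset.sum_congr rfl fun k _ => ?_).trans (h.trans ?_)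
      · have hk : ((n + 1 : ℕ) : R) * n.choose k = (n + 1).choose (k + 1) * ((k + 1 : ℕ) : R) := by
          simpa only [Nat.cast_mul] using congrArg (Nat.cast (R := R)) (Nat.add_one_mul_choose_eq n k)
        rw [Nat.succ_descFactorial_succ, Nat.add_sub_add_right]
        calc _ = ((n + 1).choose (k + 1) * ((k + 1 : ℕ) : R)) *
              (k.descFactorial j * (x * (x ^ k * y ^ (n - k)))) := by push_cast; ring
          _ = _ := by rw [← hk]; ring
      · push_cast; ring

theorem tendsto_descFactorial_div_pow (j : ℕ) :
    Tendsto (fun n : ℕ => (n.descFactorial j : ℝ) / (n : ℝ) ^ j) atTop (𝓝 1) := by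
  induction j with
  | zero => simp
  | succ j ih =>
    have h : Tendsto (fun n : ℕ => 1 - (j : ℝ) / n) atTop (𝓝 (1 - 0)) :=
      tendsto_const_nhds.sub (tendsto_const_div_atTop_nhds_zero_nat _)
    refine (by simpa using h.mul ih : Tendsto _ _ (𝓝 (1 : ℝ))).congr' ?_
    filter_upwards [eventually_ge_atTop (j + 1)] with n hn
    have hn0 : (n : ℝ) ≠ 0 := by norm_cast; omega
    rw [Nat.descFactorial_succ, Nat.cast_mul, Nat.cast_sub (by omega)]
    field_simp
    ring

/-- The linear functional on polynomials with `X ^ k ↦ a k`. -/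
noncomputable def momentFunctional (a : ℕ → ℝ) : ℝ[X] →ₗ[ℝ] ℝ :=
  Polynomial.lsum fun n => a n • LinearMap.id

theorem momentFunctional_X_pow (a : ℕ → ℝ) (k : ℕ) : momentFunctional a (X ^ k) = a k := by
  simp [momentFunctional, ← Polynomial.monomial_one_right_eq_X_pow]

theorem momentFunctional_X_pow_mul_one_sub_X_pow (a : ℕ → ℝ) (s k : ℕ) :
    momentFunctional a (X ^ k * (1 - X) ^ s) = (-1 : ℝ) ^ s * (fwdDiff 1)^[s] a k := by
  refine (neg_one_pow_mul_fwdDiff_iterate_eq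
    (c := fun s k => momentFunctional a (X ^ k * (1 - X) ^ s)) ?_ ?_ s k).symm
  · simp [momentFunctional_X_pow]
  · intro s k
    rw [← map_sub]
    congr 1
    ring

/-- The weights of the discrete approximations to the representing measure. -/
noncomputable def momentWeight (a : ℕ → ℝ) (n k : ℕ) : ℝ :=
  n.choose k * ((-1 : ℝ) ^ (n - k) * (fwdDiff 1)^[n - k] a k)

theorem sum_momentWeight_mul_descFactorial (a : ℕ → ℝ) (j n : ℕ) :
    ∑ k ∈ Finset.range (n + 1), momentWeight a n k * k.descFactorial j =
      n.descFactorial j * a j := by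
  have h := congrArg (momentFunctional a) (sum_choose_mul_descFactorial (X : ℝ[X]) (1 - X) j n)
  rw [add_sub_cancel, one_pow, mul_one, map_sum, ← nsmul_eq_mul, map_nsmul,
    momentFunctional_X_pow, nsmul_eq_mul] at h
  rw [← h]
  refine Finset.sum_congr rfl fun k _ => ?_
  rw [← Nat.cast_mul, ← nsmul_eq_mul, map_nsmul, momentFunctional_X_pow_mul_one_sub_X_pow,
    momentWeight, nsmul_eq_mul]
  push_cast
  ring

/-- Factorial moments are known exactly. Ordinary powers are reached one at a time through `k *
k.descFactorial j = k.descFactorial (j + 1) + j * k.descFactorial j`, whose last term is of lower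
order in `n`. -/
theorem tendsto_sum_momentWeight (a : ℕ → ℝ) (m j : ℕ) :
    Tendsto (fun n : ℕ => (∑ k ∈ Finset.range (n + 1),
      momentWeight a n k * (k.descFactorial j * (k : ℝ) ^ m)) / (n : ℝ) ^ (j + m))
      atTop (𝓝 (a (j + m))) := by
  induction m generalizing j with
  | zero =>
    refine (by simpa using (tendsto_descFactorial_div_pow j).mul_const (a j) :
      Tendsto _ _ (𝓝 (a (j + 0)))).congr fun n => ?_
    simp only [pow_zero, mul_one, sum_momentWeight_mul_descFactorial, add_zero]
    ring
  | succ m ih =>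
    have h1 := ih (j + 1)
    have h2 := (ih j).mul (tendsto_const_div_atTop_nhds_zero_nat (j : ℝ))
    have h := h1.add h2
    rw [mul_zero, add_zero, show j + 1 + m = j + (m + 1) by ring] at h
    refine h.congr' ?_
    filter_upwards [eventually_ge_atTop 1] with n hn
    have hn0 : (n : ℝ) ≠ 0 := by norm_cast; omega
    have hk (k : ℕ) : ((k.descFactorial (j + 1) : ℕ) : ℝ) = (k - j) * k.descFactorial j := by
      rw [Nat.descFactorial_succ, Nat.cast_mul]
      rcases le_or_gt j k with hjk | hjk
      · rw [Nat.cast_sub hjk]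
      · simp [Nat.descFactorial_of_lt hjk]
    rw [div_mul_div_comm, ← pow_succ, show j + (m + 1) = j + m + 1 by ring, ← add_div,
      Finset.sum_mul, ← Finset.sum_add_distrib]
    congr 1
    refine Finset.sum_congr rfl fun k _ => ?_
    rw [hk]
    ring

theorem integrable_of_continuous_unitInterval {ν : Measure unitInterval} [IsFiniteMeasure ν]
    {f : unitInterval → ℝ} (hf : Continuous f) : Integrable f ν :=
  hf.integrable_of_hasCompactSupport (HasCompactSupport.of_compactSpace f)

/-- The point `min (k / n) 1` of the unit interval. -/
noncomputable def gridPoint (n k : ℕ) : unitInterval :=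
  ⟨min ((k : ℝ) / n) 1, le_min (by positivity) zero_le_one, min_le_right _ _⟩

/-- **Hausdorff moment problem**, normalized: a completely monotone sequence with first term `1` is
the moment sequence of a probability measure on the unit interval. -/
theorem exists_probabilityMeasure_moments {a : ℕ → ℝ}
    (ha : ∀ s k, 0 ≤ (-1 : ℝ) ^ s * (fwdDiff 1)^[s] a k) (ha0 : a 0 = 1) :
    ∃ ν : ProbabilityMeasure unitInterval, ∀ k, ∫ u : unitInterval, (u : ℝ) ^ k ∂ν = a k := by
  have hw (n k : ℕ) : 0 ≤ momentWeight a n k := mul_nonneg (Nat.cast_nonneg _) (ha _ _)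
  let N (n : ℕ) : Measure unitInterval := ∑ k ∈ Finset.range (n + 1),
    ENNReal.ofReal (momentWeight a n k) • Measure.dirac (gridPoint n k)
  have hN (n : ℕ) : IsProbabilityMeasure (N n) := by
    constructor
    have h := sum_momentWeight_mul_descFactorial a 0 n
    simp only [Nat.descFactorial_zero, Nat.cast_one, mul_one, ha0] at h
    simp only [N, Measure.coe_finsetSum, Finset.sum_apply, Measure.smul_apply, measure_univ,
      smul_eq_mul, mul_one]
    rw [← ENNReal.ofReal_sum_of_nonneg fun k _ => hw n k, h, ENNReal.ofReal_one]
  have hint (m n : ℕ) : ∫ u : unitInterval, (u : ℝ) ^ m ∂(N n) =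
      ∑ k ∈ Finset.range (n + 1), momentWeight a n k * (gridPoint n k : ℝ) ^ m := by
    rw [integral_finsetSum_measure]
    · refine Finset.sum_congr rfl fun k _ => ?_
      rw [integral_smul_measure, integral_dirac, ENNReal.toReal_ofReal (hw n k), smul_eq_mul]
    · intro k _
      refine Integrable.smul_measure ?_ ENNReal.ofReal_ne_top
      exact integrable_of_continuous_unitInterval (by fun_prop)
  have hlim (m : ℕ) : Tendsto (fun n => ∫ u : unitInterval, (u : ℝ) ^ m ∂(N n)) atTop
      (𝓝 (a m)) := by
    have h := tendsto_sum_momentWeight a m 0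
    rw [zero_add] at h
    refine h.congr' ?_
    filter_upwards [eventually_ge_atTop 1] with n hn
    have hn0 : (0 : ℝ) < n := by norm_cast
    rw [hint, Finset.sum_div]
    refine Finset.sum_congr rfl fun k hk => ?_
    have hkn : (k : ℝ) / n ≤ 1 := by
      rw [div_le_one hn0]
      exact_mod_cast Nat.lt_succ_iff.mp (Finset.mem_range.mp hk)
    simp only [gridPoint, min_eq_left hkn, Nat.descFactorial_zero, Nat.cast_one, one_mul, div_pow]
    ring
  let p (n : ℕ) : ProbabilityMeasure unitInterval := ⟨N n, hN n⟩
  -- Probability measures on a compact space form a compact space, so a limit along an ultrafilter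
  -- exists; it stands in for a convergent subsequence.
  let G : Ultrafilter ℕ := hyperfilter ℕ
  obtain ⟨ν, -, hν⟩ := isCompact_univ.ultrafilter_le_nhds (G.map p) (by simp)
  have hν' : Tendsto p G (𝓝 ν) := hν
  refine ⟨ν, fun k => ?_⟩
  rw [ProbabilityMeasure.tendsto_iff_forall_integral_tendsto] at hν'
  exact tendsto_nhds_unique
    (hν' (BoundedContinuousFunction.mkOfCompact ⟨fun u : unitInterval => (u : ℝ) ^ k, by fun_prop⟩))
    ((hlim k).mono_left Nat.hyperfilter_le_atTop)

/-- **Hausdorff moment problem**: a completely monotone sequence is the moment sequence of a finite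
measure on the unit interval. -/
theorem exists_finiteMeasure_moments {a : ℕ → ℝ}
    (ha : ∀ s k, 0 ≤ (-1 : ℝ) ^ s * (fwdDiff 1)^[s] a k) (ha0 : 0 < a 0) :
    ∃ ν : Measure unitInterval, IsFiniteMeasure ν ∧
      ∀ k, ∫ u : unitInterval, (u : ℝ) ^ k ∂ν = a k := by
  obtain ⟨ν, hν⟩ := exists_probabilityMeasure_moments (a := (a 0)⁻¹ • a) (fun s k => by
    rw [fwdDiff_iter_const_smul, Pi.smul_apply, smul_eq_mul, mul_left_comm]
    exact mul_nonneg (inv_nonneg.mpr ha0.le) (ha s k)) (by simp [ha0.ne'])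
  refine ⟨ENNReal.ofReal (a 0) • (ν : Measure unitInterval), ?_, fun k => ?_⟩
  · exact Measure.smul_finite _ ENNReal.ofReal_ne_top
  · rw [integral_smul_measure, hν, ENNReal.toReal_ofReal ha0.le]
    simp [ha0.ne']

theorem integral_pow_mul_one_sub_pow {ν : Measure unitInterval} [IsFiniteMeasure ν] {a : ℕ → ℝ}
    (h : ∀ k, ∫ u : unitInterval, (u : ℝ) ^ k ∂ν = a k) (s k : ℕ) :
    (-1 : ℝ) ^ s * (fwdDiff 1)^[s] a k =
      ∫ u : unitInterval, (u : ℝ) ^ k * (1 - (u : ℝ)) ^ s ∂ν := by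
  refine neg_one_pow_mul_fwdDiff_iterate_eq
    (c := fun s k => ∫ u : unitInterval, (u : ℝ) ^ k * (1 - (u : ℝ)) ^ s ∂ν) ?_ ?_ s k
  · simpa using h
  · intro s k
    rw [← integral_sub]
    · congr with u
      ring
    all_goals exact integrable_of_continuous_unitInterval (by fun_prop)

/-! ### Layer-cake representation. -/

/-- The signed indicator of the interval between `c` and `x`; its integral in `w` is `x - c`. -/
noncomputable def layer (c x w : ℝ) : ℝ := (if c ≤ w then 1 else 0) - (if x ≤ w then 1 else 0)

theorem measurable_layer_uncurry (c : ℝ) : Measurable fun p : ℝ × ℝ => layer c p.1 p.2 :=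
  (Measurable.ite (measurableSet_le measurable_const measurable_snd) measurable_const
    measurable_const).sub
  (Measurable.ite (measurableSet_le measurable_fst measurable_snd) measurable_const
    measurable_const)

theorem measurable_layer (c x : ℝ) : Measurable (layer c x) :=
  (measurable_layer_uncurry c).comp measurable_prodMk_left

theorem layer_mono (c w : ℝ) : Monotone fun x => layer c x w := by
  intro x y hxy
  simp only [layer]
  split_ifs <;> linarith

theorem abs_layer (c x w : ℝ) : |layer c x w| = (if c ≤ w then 1 else -1) * layer c x w := by
  simp only [layer]
  split_ifs <;> simp

theorem abs_layer_le (c x w : ℝ) : |layer c x w| ≤ 1 := by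
  simp only [layer]
  split_ifs <;> simp

theorem layer_eq_indicator_sub (c x w : ℝ) :
    layer c x w = (Set.Ico c x).indicator 1 w - (Set.Ico x c).indicator 1 w := by
  simp only [layer, Set.indicator_apply, Set.mem_Ico, Pi.one_apply]
  split_ifs <;> grind

theorem integrable_indicator_Ico (a b : ℝ) :
    Integrable ((Set.Ico a b).indicator (1 : ℝ → ℝ)) volume :=
  (integrable_indicator_iff measurableSet_Ico).mpr (integrableOn_const (by simp))

theorem integral_indicator_Ico (a b : ℝ) :
    ∫ w, (Set.Ico a b).indicator (1 : ℝ → ℝ) w = max (b - a) 0 := by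
  rw [integral_indicator_one measurableSet_Ico, Real.volume_real_Ico]

theorem integrable_layer (c x : ℝ) : Integrable (layer c x) volume :=
  ((integrable_indicator_Ico c x).sub (integrable_indicator_Ico x c)).congr
    (ae_of_all _ fun w => (layer_eq_indicator_sub c x w).symm)

theorem integral_layer (c x : ℝ) : ∫ w, layer c x w = x - c := by
  simp only [layer_eq_indicator_sub]
  rw [integral_sub (integrable_indicator_Ico c x) (integrable_indicator_Ico x c),
    integral_indicator_Ico, integral_indicator_Ico]
  rcases le_total c x with h | h
  · rw [max_eq_left (by linarith), max_eq_right (by linarith), sub_zero]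
  · rw [max_eq_right (by linarith), max_eq_left (by linarith)]; ring

theorem integral_abs_layer (c x : ℝ) : ∫ w, |layer c x w| = |x - c| := by
  have h (w : ℝ) : |layer c x w| = layer (min c x) (max c x) w := by
    simp only [layer]
    split_ifs <;> grind
  simp only [h]
  rw [integral_layer, max_sub_min_eq_abs]

section Layer

variable {Ω : Type*} [MeasurableSpace Ω] {P : Measure Ω} [IsProbabilityMeasure P] {M : Ω → ℝ}

theorem integrable_layer_comp (hM : Measurable M) (c w : ℝ) :
    Integrable (fun ω => layer c (M ω) w) P :=
  Integrable.of_bound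
    (((measurable_layer_uncurry c).comp (hM.prodMk measurable_const)).aestronglyMeasurable) 1
    (ae_of_all _ fun _ => abs_layer_le _ _ _)

theorem integral_layer_comp (hM : Measurable M) (c w : ℝ) :
    ∫ ω, layer c (M ω) w ∂P = (if c ≤ w then 1 else 0) - P.real {ω | M ω ≤ w} := by
  have hs : MeasurableSet {ω | M ω ≤ w} := measurableSet_le hM measurable_const
  have h (ω : Ω) : layer c (M ω) w =
      (if c ≤ w then 1 else 0) - {ω | M ω ≤ w}.indicator (1 : Ω → ℝ) ω := by
    simp [layer, Set.indicator_apply]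
  simp only [h]
  rw [integral_sub (integrable_const _), integral_indicator_one hs]
  · simp
  · exact (integrable_indicator_iff hs).mpr (integrableOn_const (by simp))

/-- For fixed `w` the sign of `layer c x w` does not depend on `x`, so the absolute value passes
through the integral over `ω`. -/
theorem integral_abs_layer_comp (hM : Measurable M) (c w : ℝ) :
    ∫ ω, |layer c (M ω) w| ∂P = |(if c ≤ w then 1 else 0) - P.real {ω | M ω ≤ w}| := by
  simp only [abs_layer]
  rw [integral_const_mul, integral_layer_comp hM]
  have h1 : P.real {ω | M ω ≤ w} ≤ 1 := measureReal_le_one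
  have h0 : 0 ≤ P.real {ω | M ω ≤ w} := measureReal_nonneg
  split_ifs
  · rw [abs_of_nonneg (by linarith), one_mul]
  · rw [abs_of_nonpos (by linarith), neg_one_mul]

theorem measurable_layer_comp_uncurry (hM : Measurable M) (c : ℝ) :
    Measurable fun p : Ω × ℝ => layer c (M p.1) p.2 :=
  (measurable_layer_uncurry c).comp ((hM.comp measurable_fst).prodMk measurable_snd)

theorem integrable_layer_prod_iff {m : Measure ℝ} [SFinite m] (hM : Measurable M) (c : ℝ) :
    Integrable (fun p : Ω × ℝ => layer c (M p.1) p.2) (P.prod m) ↔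
      Integrable (fun w => (if c ≤ w then 1 else 0) - P.real {ω | M ω ≤ w}) m := by
  constructor
  · intro h
    refine h.integral_prod_right.congr (ae_of_all _ fun w => ?_)
    exact integral_layer_comp hM c w
  · intro h
    rw [integrable_prod_iff' (measurable_layer_comp_uncurry hM c).aestronglyMeasurable]
    refine ⟨ae_of_all _ fun w => integrable_layer_comp hM c w, ?_⟩
    refine h.abs.congr (ae_of_all _ fun w => ?_)
    simp only [Real.norm_eq_abs]
    exact (integral_abs_layer_comp hM c w).symm

/-- The integrated layer function of `M` has the expected mean. -/
theorem integrable_and_integral_integral_layer {m : Measure ℝ} [SFinite m] (hM : Measurable M)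
    (c : ℝ) (h : Integrable (fun w => (if c ≤ w then 1 else 0) - P.real {ω | M ω ≤ w}) m) :
    Integrable (fun ω => ∫ w, layer c (M ω) w ∂m) P ∧
      ∫ ω, ∫ w, layer c (M ω) w ∂m ∂P =
        ∫ w, ((if c ≤ w then 1 else 0) - P.real {ω | M ω ≤ w}) ∂m := by
  have hp := (integrable_layer_prod_iff hM c).mpr h
  refine ⟨hp.integral_prod_left, ?_⟩
  rw [integral_integral_swap hp]
  simp only [integral_layer_comp hM]

theorem integrable_step_sub_cdf (hM : Measurable M) (hint : Integrable M P) :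
    Integrable (fun w : ℝ => (if 0 ≤ w then 1 else 0) - P.real {ω | M ω ≤ w}) volume := by
  rw [← integrable_layer_prod_iff hM 0, integrable_prod_iff
    (measurable_layer_comp_uncurry hM 0).aestronglyMeasurable]
  refine ⟨ae_of_all _ fun ω => integrable_layer 0 (M ω), ?_⟩
  simpa only [Real.norm_eq_abs, integral_abs_layer, sub_zero] using hint.abs

end Layer

/-- Bernoulli's inequality handles `e = 1`. The bound carries integrability from exponent 1 to
exponent `k`, and its linear growth in `k` gives the dominating function for the `o(k)` estimates.
-/
theorem abs_sub_pow_le {e x : ℝ} (he : e = 0 ∨ e = 1) (hx0 : 0 ≤ x) (hx1 : x ≤ 1) {k : ℕ}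
    (hk : 1 ≤ k) : |e - x ^ k| ≤ k * |e - x| := by
  have hk' : (1 : ℝ) ≤ k := by exact_mod_cast hk
  rcases he with rfl | rfl
  · rw [zero_sub, zero_sub, abs_neg, abs_neg, abs_of_nonneg (by positivity), abs_of_nonneg hx0]
    calc x ^ k ≤ x ^ 1 := pow_le_pow_of_le_one hx0 hx1 hk
      _ ≤ k * x := by nlinarith
  · rw [abs_of_nonneg (sub_nonneg.mpr (pow_le_one₀ hx0 hx1)), abs_of_nonneg (by linarith)]
    have := one_add_mul_sub_le_pow (by linarith : -1 ≤ x) k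
    linarith

/-! ### Expected maxima in terms of the distribution function. -/

section ExpectedMax

variable {Ω : Type*} [MeasurableSpace Ω] {P : Measure Ω} [IsProbabilityMeasure P] {V : Ω → ℝ}

theorem measurable_iSup_eval (hV : Measurable V) (k : ℕ) :
    Measurable fun ω : Fin k → Ω => ⨆ i, V (ω i) :=
  Measurable.iSup fun i => hV.comp (measurable_pi_apply i)

theorem measureReal_iSup_le (V : Ω → ℝ) {k : ℕ} (hk : 1 ≤ k) (w : ℝ) :
    (Measure.pi fun _ : Fin k => P).real {ω | ⨆ i, V (ω i) ≤ w} =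
      P.real {ω | V ω ≤ w} ^ k := by
  have : Nonempty (Fin k) := ⟨⟨0, hk⟩⟩
  have h : {ω : Fin k → Ω | ⨆ i, V (ω i) ≤ w} = Set.univ.pi fun _ => {ω | V ω ≤ w} := by
    ext ω
    simp [ciSup_le_iff (Set.finite_range fun i => V (ω i)).bddAbove]
  rw [h, measureReal_def, Measure.pi_pi]
  simp [measureReal_def]

theorem measurable_measureReal_le (V : Ω → ℝ) : Measurable fun w => P.real {ω | V ω ≤ w} := by
  refine Monotone.measurable fun a b hab => measureReal_mono ?_
  exact fun ω (h : V ω ≤ a) => h.trans hab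

theorem ite_eq_zero_or_one (p : Prop) [Decidable p] :
    (if p then (1 : ℝ) else 0) = 0 ∨ (if p then (1 : ℝ) else 0) = 1 := by
  split_ifs <;> simp

theorem integrable_step_sub_cdf_pow {m : Measure ℝ} {c : ℝ}
    (h : Integrable (fun w => (if c ≤ w then 1 else 0) - P.real {ω | V ω ≤ w}) m) {k : ℕ}
    (hk : 1 ≤ k) :
    Integrable (fun w => (if c ≤ w then 1 else 0) - P.real {ω | V ω ≤ w} ^ k) m := by
  refine (h.abs.const_mul (k : ℝ)).mono' ?_ (ae_of_all _ fun w => ?_)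
  · exact ((Measurable.ite measurableSet_Ici measurable_const measurable_const).sub
      ((measurable_measureReal_le V).pow_const k)).aestronglyMeasurable
  · exact abs_sub_pow_le (ite_eq_zero_or_one _) measureReal_nonneg measureReal_le_one hk

/-- The expected maximum of copies of `X = G ∘ V + d`, where `G` is the monotone function with
associated measure `m`. -/
theorem expectedMax_integral_layer {m : Measure ℝ} [SFinite m] (hV : Measurable V) {c : ℝ}
    (hl : ∀ ω, Integrable (layer c (V ω)) m)
    (h : Integrable (fun w => (if c ≤ w then 1 else 0) - P.real {ω | V ω ≤ w}) m) (d : ℝ) {k : ℕ}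
    (hk : 1 ≤ k) :
    expectedMax P (fun ω => ∫ w, layer c (V ω) w ∂m + d) k =
      ∫ w, ((if c ≤ w then 1 else 0) - P.real {ω | V ω ≤ w} ^ k) ∂m + d := by
  have : Nonempty (Fin k) := ⟨⟨0, hk⟩⟩
  -- A nondecreasing function commutes with a finite maximum.
  have hmax (ω : Fin k → Ω) : ⨆ i, (∫ w, layer c (V (ω i)) w ∂m + d) =
      ∫ w, layer c (⨆ i, V (ω i)) w ∂m + d := by
    obtain ⟨i₀, hi₀⟩ := exists_eq_ciSup_of_finite (f := fun i => V (ω i))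
    rw [← hi₀]
    refine le_antisymm (ciSup_le fun i => ?_)
      (le_ciSup (f := fun i => ∫ w, layer c (V (ω i)) w ∂m + d) (Set.finite_range _).bddAbove i₀)
    refine add_le_add_left (integral_mono (hl _) (hl _) fun w => layer_mono c w ?_) d
    rw [hi₀]
    exact le_ciSup (f := fun i => V (ω i)) (Set.finite_range _).bddAbove i
  have hk' := integrable_step_sub_cdf_pow h hk
  simp only [← measureReal_iSup_le V hk] at hk' ⊢
  obtain ⟨h1, h2⟩ := integrable_and_integral_integral_layer (measurable_iSup_eval hV k) c hk'
  simp only [expectedMax, hmax]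
  rw [integral_add h1 (integrable_const d), h2]
  simp

theorem expectedMax_eq_integral (hV : Measurable V) (hint : Integrable V P) {k : ℕ} (hk : 1 ≤ k) :
    expectedMax P V k =
      ∫ w : ℝ, ((if 0 ≤ w then 1 else 0) - P.real {ω | V ω ≤ w} ^ k) := by
  have h := expectedMax_integral_layer hV (fun ω => integrable_layer 0 (V ω))
    (integrable_step_sub_cdf hV hint) 0 hk
  simpa only [integral_layer, sub_zero, add_zero] using h

theorem expectedMax_eq_of_ae_eq_const {c : ℝ} (h : ∀ᵐ ω ∂P, V ω = c) {k : ℕ} (hk : 1 ≤ k) :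
    expectedMax P V k = c := by
  have : Nonempty (Fin k) := ⟨⟨0, hk⟩⟩
  have h' : ∀ᵐ ω ∂(Measure.pi fun _ : Fin k => P), ⨆ i, V (ω i) = c := by
    have hall : ∀ᵐ ω ∂(Measure.pi fun _ : Fin k => P), ∀ i, V (ω i) = c :=
      ae_all_iff.mpr fun i => (measurePreserving_eval (fun _ : Fin k => P) i).quasiMeasurePreserving.ae (p := fun ω => V ω = c) h
    filter_upwards [hall] with ω hω
    simp [hω]
  rw [expectedMax, integral_congr_ae h']
  simp

end ExpectedMax

/-! ### Necessity of the three conditions. -/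

theorem isLittleO_natCast_of_tendsto_div {g : ℕ → ℝ}
    (h : Tendsto (fun k : ℕ => g k / k) atTop (𝓝 0)) :
    Asymptotics.IsLittleO atTop g fun k : ℕ => (k : ℝ) := by
  refine (Asymptotics.isLittleO_iff_tendsto' ?_).mpr h
  filter_upwards [eventually_ge_atTop 1] with k hk h0
  norm_cast at h0
  omega

theorem isLittleO_integral_sub_pow {m : Measure ℝ} {e x : ℝ → ℝ} (he : Measurable e)
    (hx : Measurable x) (he01 : ∀ w, e w = 0 ∨ e w = 1) (hx0 : ∀ w, 0 ≤ x w) (hx1 : ∀ w, x w ≤ 1)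
    (hint : Integrable (fun w => e w - x w) m) :
    Asymptotics.IsLittleO atTop (fun k : ℕ => ∫ w, (e w - x w ^ k) ∂m) fun k : ℕ => (k : ℝ) := by
  refine isLittleO_natCast_of_tendsto_div ?_
  simp only [← integral_div]
  rw [← integral_zero ℝ ℝ (μ := m)]
  refine tendsto_integral_filter_of_dominated_convergence (fun w => |e w - x w|) ?_ ?_ hint.abs ?_
  · exact Eventually.of_forall fun k =>
      ((he.sub (hx.pow_const k)).div_const _).aestronglyMeasurable
  · filter_upwards [eventually_ge_atTop 1] with k hk
    refine ae_of_all _ fun w => ?_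
    rw [Real.norm_eq_abs, abs_div, Nat.abs_cast, div_le_iff₀ (by exact_mod_cast hk), mul_comm]
    exact abs_sub_pow_le (he01 w) (hx0 w) (hx1 w) hk
  · refine ae_of_all _ fun w => ?_
    refine squeeze_zero_norm (fun k => ?_) (tendsto_const_div_atTop_nhds_zero_nat (1 : ℝ))
    rw [Real.norm_eq_abs, abs_div, Nat.abs_cast]
    gcongr
    have h1 : x w ^ k ≤ 1 := pow_le_one₀ (hx0 w) (hx1 w)
    have h0 : 0 ≤ x w ^ k := pow_nonneg (hx0 w) k
    rw [abs_le]
    rcases he01 w with h | h <;> constructor <;> linarith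

theorem sum_neg_one_pow_mul_choose_mul_pow (x : ℝ) (k : ℕ) :
    ∑ j ∈ Finset.Icc 1 k, (-1 : ℝ) ^ j * (k.choose j : ℝ) * x ^ j = (1 - x) ^ k - 1 := by
  have hr : Finset.range (k + 1) = insert 0 (Finset.Icc 1 k) := by
    ext j
    simp only [Finset.mem_range, Finset.mem_insert, Finset.mem_Icc]
    omega
  have h := add_pow (-x) 1 k
  rw [hr, Finset.sum_insert (by simp)] at h
  rw [sub_eq_neg_add 1 x, h]
  simp only [pow_zero, Nat.choose_zero_right, Nat.cast_one, one_pow, mul_one, add_sub_cancel_left]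
  refine Finset.sum_congr rfl fun j _ => ?_
  rw [neg_pow]
  ring

/-- Otherwise `X` almost surely lies in, or almost surely avoids, each half-line `Iic t`; countably
many of these separate points, so `X` would be constant. -/
theorem exists_measureReal_le_mem_Ioo {Ω : Type*} [MeasurableSpace Ω] {P : Measure Ω}
    [IsProbabilityMeasure P] {X : Ω → ℝ} (hX : Measurable X) (hdeg : ¬ IsDegenerate P X) :
    ∃ t, 0 < P.real {ω | X ω ≤ t} ∧ P.real {ω | X ω ≤ t} < 1 := by
  by_contra! hcon
  have : HasCountableSeparatingOn ℝ (· ∈ Set.range Set.Iic) Set.univ :=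
    HasCountableSeparatingOn.range_Iic
  refine hdeg (exists_eventuallyEq_const_of_forall_separating (· ∈ Set.range Set.Iic) ?_)
  rintro _ ⟨t, rfl⟩
  have hs : MeasurableSet {ω | X ω ≤ t} := measurableSet_le hX measurable_const
  rcases (measureReal_nonneg (μ := P) (s := {ω | X ω ≤ t})).eq_or_lt with h | h
  · right
    rw [eq_comm, measureReal_eq_zero_iff, measure_eq_zero_iff_ae_notMem] at h
    exact h
  · left
    have h1 : P.real {ω | X ω ≤ t} = 1 := le_antisymm measureReal_le_one (hcon t h)
    rw [measureReal_def, ENNReal.toReal_eq_one_iff, ← mem_ae_iff_prob_eq_one hs] at h1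
    exact h1

theorem integral_cdf_pow_mul_one_sub_cdf_pow_pos {Ω : Type*} [MeasurableSpace Ω] {P : Measure Ω}
    [IsProbabilityMeasure P] {X : Ω → ℝ} (hX : Measurable X) (hdeg : ¬ IsDegenerate P X) {j s : ℕ}
    (hint : Integrable fun w => P.real {ω | X ω ≤ w} ^ j * (1 - P.real {ω | X ω ≤ w}) ^ s) :
    0 < ∫ w, P.real {ω | X ω ≤ w} ^ j * (1 - P.real {ω | X ω ≤ w}) ^ s := by
  rw [integral_pos_iff_support_of_nonneg _ hint]
  · have : IsProbabilityMeasure (P.map X) := Measure.isProbabilityMeasure_map hX.aemeasurable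
    have hF (w : ℝ) : P.real {ω | X ω ≤ w} = ProbabilityTheory.cdf (P.map X) w := by
      rw [ProbabilityTheory.cdf_eq_real, map_measureReal_apply hX measurableSet_Iic]
      rfl
    simp only [hF]
    obtain ⟨t, h0, h1⟩ := exists_measureReal_le_mem_Ioo hX hdeg
    rw [hF] at h0 h1
    -- Right continuity keeps the value below 1 just after `t`, and monotonicity keeps it positive,
    -- so the integrand is nonzero on an open interval.
    have hright : ∀ᶠ w in 𝓝[>] t, ProbabilityTheory.cdf (P.map X) w < 1 :=
      (((ProbabilityTheory.cdf (P.map X)).right_continuous t).mono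
        Set.Ioi_subset_Ici_self).eventually_lt_const h1
    obtain ⟨b, hb, hsub⟩ := mem_nhdsGT_iff_exists_Ioo_subset.mp hright
    refine lt_of_lt_of_le ?_ (measure_mono (s := Set.Ioo t b) fun w hw => ?_)
    · simpa using hb
    · have hpos := h0.trans_le (ProbabilityTheory.monotone_cdf (P.map X) hw.1.le)
      have hlt : ProbabilityTheory.cdf (P.map X) w < 1 := hsub hw
      exact (mul_pos (pow_pos hpos j) (pow_pos (sub_pos.mpr hlt) s)).ne'
  · intro w
    have h1 : P.real {ω | X ω ≤ w} ≤ 1 := measureReal_le_one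
    exact mul_nonneg (pow_nonneg measureReal_nonneg j) (pow_nonneg (sub_nonneg.mpr h1) s)

section Necessity

variable {Ω : Type*} [MeasurableSpace Ω] {P : Measure Ω} [IsProbabilityMeasure P] {X : Ω → ℝ}
  {μ : ℕ → ℝ}

theorem integrable_cdf_pow_mul_one_sub_cdf_pow (hX : Measurable X) (hint : Integrable X P)
    (s k : ℕ) :
    Integrable fun w => P.real {ω | X ω ≤ w} ^ (k + 1) * (1 - P.real {ω | X ω ≤ w}) ^ (s + 1) := by
  have hF := integrable_step_sub_cdf hX hint
  have h := (integrable_step_sub_cdf_pow hF (show 1 ≤ k + 2 by omega)).sub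
    (integrable_step_sub_cdf_pow hF (show 1 ≤ k + 1 by omega))
  have hm := measurable_measureReal_le (P := P) X
  refine h.mono ((hm.pow_const _).mul
    ((measurable_const.sub hm).pow_const _)).aestronglyMeasurable (ae_of_all _ fun w => ?_)
  have h1 : P.real {ω | X ω ≤ w} ≤ 1 := measureReal_le_one
  have h0 : 0 ≤ P.real {ω | X ω ≤ w} := measureReal_nonneg
  simp only [Pi.sub_apply]
  generalize P.real {ω | X ω ≤ w} = x at *
  have hx : (1 - x) ^ s ≤ 1 := pow_le_one₀ (by linarith) (by linarith)
  rw [show ∀ e : ℝ, e - x ^ (k + 2) - (e - x ^ (k + 1)) = x ^ (k + 1) * (1 - x) by intro e; ring,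
    Real.norm_of_nonneg (by have := sub_nonneg.mpr h1; positivity),
    Real.norm_of_nonneg (by have := sub_nonneg.mpr h1; positivity)]
  gcongr
  rw [pow_succ]
  exact mul_le_of_le_one_left (by linarith) hx

theorem fwdDiff_pos_of_expectedMax (hX : Measurable X) (hint : Integrable X P)
    (hdeg : ¬ IsDegenerate P X) (hμ : ∀ k, 1 ≤ k → expectedMax P X k = μ k) {s k : ℕ}
    (hs : 1 ≤ s) (hk : 1 ≤ k) : 0 < (-1 : ℝ) ^ (s + 1) * (fwdDiff 1)^[s] μ k := by
  obtain ⟨s, rfl⟩ := Nat.exists_eq_add_of_le' hs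
  obtain ⟨k, rfl⟩ := Nat.exists_eq_add_of_le' hk
  have hF := integrable_step_sub_cdf hX hint
  have hI := integrable_cdf_pow_mul_one_sub_cdf_pow hX hint
  have key := neg_one_pow_mul_fwdDiff_iterate_eq (a := fun j => fwdDiff 1 μ (j + 1))
    (c := fun s k => ∫ w, P.real {ω | X ω ≤ w} ^ (k + 1) * (1 - P.real {ω | X ω ≤ w}) ^ (s + 1))
    (fun k => by
      rw [fwdDiff, ← hμ _ (by omega), ← hμ _ (by omega), expectedMax_eq_integral hX hint (by omega),
        expectedMax_eq_integral hX hint (by omega), ← integral_sub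
          (integrable_step_sub_cdf_pow hF (by omega)) (integrable_step_sub_cdf_pow hF (by omega))]
      congr with w
      ring)
    (fun s k => by
      rw [← integral_sub (hI s k) (hI s (k + 1))]
      congr with w
      ring) s k
  rw [fwdDiff_iterate_fwdDiff_shift] at key
  rw [pow_succ, pow_succ, mul_neg_one, mul_neg_one, neg_neg, key]
  exact integral_cdf_pow_mul_one_sub_cdf_pow_pos hX hdeg (hI s k)

theorem isLittleO_of_expectedMax (hX : Measurable X) (hint : Integrable X P)
    (hμ : ∀ k, 1 ≤ k → expectedMax P X k = μ k) :
    Asymptotics.IsLittleO atTop μ fun k : ℕ => (k : ℝ) := by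
  refine (isLittleO_integral_sub_pow (Measurable.ite measurableSet_Ici measurable_const
    measurable_const) (measurable_measureReal_le X) (fun w => ite_eq_zero_or_one (0 ≤ w))
    (fun w => measureReal_nonneg) (fun w => measureReal_le_one)
    (integrable_step_sub_cdf hX hint)).congr' ?_ EventuallyEq.rfl
  filter_upwards [eventually_ge_atTop 1] with k hk
  rw [← hμ k hk, expectedMax_eq_integral hX hint hk]

theorem isLittleO_sum_of_expectedMax (hX : Measurable X) (hint : Integrable X P)
    (hμ : ∀ k, 1 ≤ k → expectedMax P X k = μ k) :
    Asymptotics.IsLittleO atTop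
      (fun k : ℕ => ∑ j ∈ Finset.Icc 1 k, (-1 : ℝ) ^ j * (k.choose j : ℝ) * μ j)
      fun k : ℕ => (k : ℝ) := by
  have hF := integrable_step_sub_cdf hX hint
  have hite : Measurable fun w : ℝ => if 0 ≤ w then (1 : ℝ) else 0 :=
    Measurable.ite measurableSet_Ici measurable_const measurable_const
  -- The binomial theorem collapses the alternating sum to the same integral with `F` and the step
  -- replaced by their complements.
  refine (isLittleO_integral_sub_pow (m := volume) (e := fun w => 1 - if 0 ≤ w then 1 else 0)
    (x := fun w => 1 - P.real {ω | X ω ≤ w}) (measurable_const.sub hite)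
    (measurable_const.sub (measurable_measureReal_le X))
    (fun w => by split_ifs <;> simp) (fun w => sub_nonneg.mpr measureReal_le_one)
    (fun w => sub_le_self _ measureReal_nonneg) ?_).congr' ?_ EventuallyEq.rfl
  · refine hF.neg.congr (ae_of_all _ fun w => ?_)
    simp only [Pi.neg_apply]
    ring
  · filter_upwards [eventually_ge_atTop 1] with k hk
    have hsum : ∑ j ∈ Finset.Icc 1 k, (-1 : ℝ) ^ j * (k.choose j : ℝ) * μ j =
        ∑ j ∈ Finset.Icc 1 k, ∫ w : ℝ, (-1 : ℝ) ^ j * (k.choose j : ℝ) *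
          ((if 0 ≤ w then 1 else 0) - P.real {ω | X ω ≤ w} ^ j) := by
      refine Finset.sum_congr rfl fun j hj => ?_
      have hj1 := (Finset.mem_Icc.mp hj).1
      rw [integral_const_mul, ← hμ j hj1, expectedMax_eq_integral hX hint hj1]
    rw [hsum, ← integral_finsetSum _ fun j hj =>
      (integrable_step_sub_cdf_pow hF (Finset.mem_Icc.mp hj).1).const_mul _]
    congr with w
    have h1 := sum_neg_one_pow_mul_choose_mul_pow 1 k
    simp only [one_pow, mul_one, sub_self, zero_pow (by omega : k ≠ 0)] at h1
    simp only [mul_sub, Finset.sum_sub_distrib, ← Finset.sum_mul]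
    rw [h1, sum_neg_one_pow_mul_choose_mul_pow]
    ring

end Necessity

/-! ### Sufficiency: the representing measure has no atoms at the endpoints. -/

theorem fwdDiff_iterate_congr_shift {f g : ℕ → ℝ} {k : ℕ} (h : ∀ j, k ≤ j → f j = g j) (s : ℕ) :
    ∀ j, k ≤ j → (fwdDiff 1)^[s] f j = (fwdDiff 1)^[s] g j := by
  induction s with
  | zero => exact h
  | succ s ih =>
    intro j hj
    rw [fwdDiff_iterate_succ_apply, fwdDiff_iterate_succ_apply, ih j hj, ih (j + 1) (by omega)]

theorem sum_neg_one_pow_mul_choose_succ_sub (μ : ℕ → ℝ) (k : ℕ) :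
    ∑ j ∈ Finset.Icc 1 (k + 1), (-1 : ℝ) ^ j * ((k + 1).choose j : ℝ) * μ j -
      ∑ j ∈ Finset.Icc 1 k, (-1 : ℝ) ^ j * (k.choose j : ℝ) * μ j =
      (-1 : ℝ) ^ (k + 1) * (fwdDiff 1)^[k] μ 1 := by
  -- The value 0 at index 0 supplies the missing `j = 0` term, making the sum a signed `k`-th
  -- difference at 0.
  let f : ℕ → ℝ := fun j => if j = 0 then 0 else μ j
  have hS (k : ℕ) : ∑ j ∈ Finset.Icc 1 k, (-1 : ℝ) ^ j * (k.choose j : ℝ) * μ j =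
      (-1 : ℝ) ^ k * (fwdDiff 1)^[k] f 0 := by
    have hr : Finset.range (k + 1) = insert 0 (Finset.Icc 1 k) := by
      ext j
      simp only [Finset.mem_range, Finset.mem_insert, Finset.mem_Icc]
      omega
    rw [fwdDiff_iter_eq_sum_shift, hr, Finset.sum_insert (by simp), mul_add]
    have h0 : f (0 + 0 • 1) = 0 := by simp [f]
    rw [h0, smul_zero, mul_zero, zero_add, Finset.mul_sum]
    refine Finset.sum_congr rfl fun j hj => ?_
    obtain ⟨hj1, hjk⟩ := Finset.mem_Icc.mp hj
    have hf : f (0 + j • 1) = μ j := by simp [f, show j ≠ 0 by omega]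
    rw [hf, zsmul_eq_mul]
    push_cast
    have hpow : (-1 : ℝ) ^ k * (-1) ^ (k - j) = (-1) ^ j := by
      obtain ⟨i, rfl⟩ := Nat.exists_eq_add_of_le hjk
      rw [Nat.add_sub_cancel_left, pow_add, mul_assoc, ← mul_pow]
      simp
    rw [← hpow]
    ring
  rw [hS, hS, fwdDiff_iterate_succ_apply,
    fwdDiff_iterate_congr_shift (k := 1) (g := μ) (f := f)
      (fun j hj => by simp [f, show j ≠ 0 by omega]) k (0 + 1) le_rfl]
  ring

theorem nonpos_of_le_sub_of_isLittleO {g : ℕ → ℝ} {δ : ℝ}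
    (hg : ∀ k, 1 ≤ k → δ ≤ g (k + 1) - g k)
    (ho : Asymptotics.IsLittleO atTop g fun k : ℕ => (k : ℝ)) : δ ≤ 0 := by
  have hlow (k : ℕ) : g 1 - δ + (k + 1 : ℕ) * δ ≤ g (k + 1) := by
    induction k with
    | zero => simp
    | succ k ih =>
      have := hg (k + 1) (by omega)
      push_cast at ih ⊢
      linarith
  have h1 : Tendsto (fun k : ℕ => (g 1 - δ) / k + δ) atTop (𝓝 (0 + δ)) :=
    (tendsto_const_div_atTop_nhds_zero_nat _).add_const δ
  rw [zero_add] at h1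
  refine le_of_tendsto_of_tendsto h1 ho.tendsto_div_nhds_zero ?_
  filter_upwards [eventually_ge_atTop 1] with k hk
  obtain ⟨k, rfl⟩ := Nat.exists_eq_add_of_le' hk
  have hk0 : (0 : ℝ) < ((k + 1 : ℕ) : ℝ) := by positivity
  rw [div_add' _ _ _ hk0.ne', mul_comm δ]
  gcongr
  exact hlow k

theorem measureReal_singleton_le_integral {ν : Measure unitInterval} [IsFiniteMeasure ν]
    {f : unitInterval → ℝ} (hf : Continuous f) (h0 : ∀ u, 0 ≤ f u) {x : unitInterval}
    (hx : f x = 1) : ν.real {x} ≤ ∫ u, f u ∂ν := by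
  rw [← integral_indicator_one (measurableSet_singleton x)]
  refine integral_mono ((integrable_indicator_iff (measurableSet_singleton x)).mpr
    (integrableOn_const (by simp))) (integrable_of_continuous_unitInterval hf) fun u => ?_
  by_cases hu : u = x
  · simp [hu, hx]
  · simpa [hu] using h0 u

/-- The increments of a sequence satisfying the sign and growth conditions are the moments of a
finite measure on the open unit interval. -/
theorem exists_measure_Ioo_moments {μ : ℕ → ℝ}
    (h1 : ∀ s k : ℕ, 1 ≤ s → 1 ≤ k → 0 < (-1 : ℝ) ^ (s + 1) * (fwdDiff 1)^[s] μ k)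
    (h2 : Asymptotics.IsLittleO atTop μ (fun k : ℕ => (k : ℝ)))
    (h3 : Asymptotics.IsLittleO atTop
      (fun k : ℕ => ∑ j ∈ Finset.Icc 1 k, (-1 : ℝ) ^ j * (k.choose j : ℝ) * μ j)
      (fun k : ℕ => (k : ℝ))) :
    ∃ m : Measure ℝ, IsFiniteMeasure m ∧ (∀ᵐ w ∂m, w ∈ Set.Ioo (0 : ℝ) 1) ∧
      ∀ k, ∫ w, w ^ k ∂m = μ (k + 2) - μ (k + 1) := by
  have hpos (s k : ℕ) : 0 < (-1 : ℝ) ^ s * (fwdDiff 1)^[s] (fun j => fwdDiff 1 μ (j + 1)) k := by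
    have h := h1 (s + 1) (k + 1) (by omega) (by omega)
    rwa [pow_succ, pow_succ, mul_neg_one, mul_neg_one, neg_neg,
      ← fwdDiff_iterate_fwdDiff_shift] at h
  obtain ⟨ν, hfin, hν⟩ := exists_finiteMeasure_moments (fun s k => (hpos s k).le)
    (by simpa using hpos 0 0)
  -- An atom at 1 bounds every increment of `μ` from below, forcing linear growth.
  have hone : ν {1} = 0 := by
    rw [← measureReal_eq_zero_iff]
    refine le_antisymm (nonpos_of_le_sub_of_isLittleO (fun k hk => ?_) h2) measureReal_nonneg
    obtain ⟨k, rfl⟩ := Nat.exists_eq_add_of_le' hk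
    refine (measureReal_singleton_le_integral (f := fun u : unitInterval => (u : ℝ) ^ k)
      (by fun_prop) (fun u => pow_nonneg u.2.1 k) (by simp)).trans_eq (hν k)
  -- The increments of the alternating sum are the integrals of `(1 - u) ^ k`, which an atom at 0
  -- bounds from below.
  have hzero : ν {0} = 0 := by
    rw [← measureReal_eq_zero_iff]
    refine le_antisymm (nonpos_of_le_sub_of_isLittleO (fun k hk => ?_) h3) measureReal_nonneg
    obtain ⟨k, rfl⟩ := Nat.exists_eq_add_of_le' hk
    refine (measureReal_singleton_le_integral (f := fun u : unitInterval => (1 - (u : ℝ)) ^ k)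
      (by fun_prop) (fun u => pow_nonneg (sub_nonneg.mpr u.2.2) k) (by simp)).trans_eq ?_
    have h := integral_pow_mul_one_sub_pow hν k 0
    simp only [pow_zero, one_mul] at h
    rw [sum_neg_one_pow_mul_choose_succ_sub, ← h, fwdDiff_iterate_fwdDiff_shift, pow_succ, pow_succ,
      mul_neg_one, mul_neg_one, neg_neg]
  refine ⟨ν.map (↑), inferInstance, ?_, fun k => ?_⟩
  · refine (ae_map_iff measurable_subtype_coe.aemeasurable measurableSet_Ioo).mpr ?_
    filter_upwards [measure_eq_zero_iff_ae_notMem.mp hone,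
      measure_eq_zero_iff_ae_notMem.mp hzero] with u hu1 hu0
    exact ⟨unitInterval.pos_iff_ne_zero.mpr hu0, unitInterval.lt_one_iff_ne_one.mpr hu1⟩
  · rw [integral_map measurable_subtype_coe.aemeasurable (by fun_prop)]
    exact hν k

/-! ### Sufficiency: construction of the random variable. -/

/-- The density `1 / (w (1 - w))` on the open unit interval. -/
noncomputable def betaDensity (w : ℝ) : NNReal := (1 / (w * (1 - w))).toNNReal

theorem measurable_betaDensity : Measurable betaDensity := by
  unfold betaDensity
  fun_prop

theorem coe_betaDensity {w : ℝ} (hw : w ∈ Set.Ioo (0 : ℝ) 1) :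
    (betaDensity w : ℝ) = 1 / (w * (1 - w)) :=
  Real.coe_toNNReal _ (one_div_nonneg.mpr (mul_nonneg hw.1.le (sub_nonneg.mpr hw.2.le)))

theorem integrable_withDensity_betaDensity {m : Measure ℝ} [IsFiniteMeasure m]
    (hm : ∀ᵐ w ∂m, w ∈ Set.Ioo (0 : ℝ) 1) {f : ℝ → ℝ} (hf : Measurable f) {C : ℝ}
    (hC : ∀ w ∈ Set.Ioo (0 : ℝ) 1, |f w| ≤ C * (w * (1 - w))) :
    Integrable f (m.withDensity fun w => betaDensity w) := by
  rw [integrable_withDensity_iff_integrable_smul measurable_betaDensity]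
  refine Integrable.of_bound (measurable_betaDensity.smul hf).aestronglyMeasurable C ?_
  filter_upwards [hm] with w hw
  have hpos : 0 < w * (1 - w) := mul_pos hw.1 (sub_pos.mpr hw.2)
  rw [NNReal.smul_def, smul_eq_mul, Real.norm_eq_abs, abs_mul, coe_betaDensity hw,
    abs_of_pos (one_div_pos.mpr hpos), one_div_mul_eq_div, div_le_iff₀ hpos]
  exact hC w hw

theorem integral_withDensity_betaDensity {m : Measure ℝ} (hm : ∀ᵐ w ∂m, w ∈ Set.Ioo (0 : ℝ) 1)
    (k : ℕ) : ∫ w, (w ^ (k + 1) - w ^ (k + 2)) ∂(m.withDensity fun w => betaDensity w) =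
      ∫ w, w ^ k ∂m := by
  rw [integral_withDensity_eq_integral_smul measurable_betaDensity]
  refine integral_congr_ae ?_
  filter_upwards [hm] with w hw
  have h0 : w ≠ 0 := hw.1.ne'
  have h1 : 1 - w ≠ 0 := (sub_pos.mpr hw.2).ne'
  rw [NNReal.smul_def, smul_eq_mul, coe_betaDensity hw]
  field_simp
  ring

theorem integrable_layer_withDensity_betaDensity {m : Measure ℝ} [IsFiniteMeasure m]
    (hm : ∀ᵐ w ∂m, w ∈ Set.Ioo (0 : ℝ) 1) {c x : ℝ} (hc : c ∈ Set.Ioo (0 : ℝ) 1)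
    (hx : x ∈ Set.Ioo (0 : ℝ) 1) :
    Integrable (layer c x) (m.withDensity fun w => betaDensity w) := by
  have ha : 0 < min c x := lt_min hc.1 hx.1
  have hb : 0 < 1 - max c x := sub_pos.mpr (max_lt hc.2 hx.2)
  refine integrable_withDensity_betaDensity hm (measurable_layer c x)
    -- The layer is supported between `c` and `x`, where `w * (1 - w)` is at least the reciprocal of
    -- this constant.
    (C := 1 / (min c x * (1 - max c x))) fun w hw => ?_
  by_cases h : min c x ≤ w ∧ w ≤ max c x
  · refine (abs_layer_le c x w).trans ?_
    rw [one_div_mul_eq_div, one_le_div (by positivity)]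
    exact mul_le_mul h.1 (by linarith [h.2]) hb.le hw.1.le
  · have h0 : layer c x w = 0 := by
      simp only [layer]
      split_ifs <;> grind
    rw [h0, abs_zero]
    exact mul_nonneg (by positivity) (mul_nonneg hw.1.le (sub_nonneg.mpr hw.2.le))

/-- Clamp a real number to the open unit interval. -/
noncomputable def clampIoo (w : ℝ) : ℝ := if w ∈ Set.Ioo (0 : ℝ) 1 then w else 1 / 2

theorem clampIoo_mem (w : ℝ) : clampIoo w ∈ Set.Ioo (0 : ℝ) 1 := by
  unfold clampIoo
  split_ifs with h
  · exact h
  · norm_num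

theorem measurable_clampIoo : Measurable clampIoo :=
  Measurable.ite measurableSet_Ioo measurable_id measurable_const

/-- The uniform distribution on the open unit interval, lifted to an arbitrary universe. -/
noncomputable def uniformULift : Measure (ULift.{u} ℝ) :=
  (volume.restrict (Set.Ioo (0 : ℝ) 1)).map ULift.up

instance isProbabilityMeasure_uniformULift : IsProbabilityMeasure uniformULift.{u} := by
  have : IsProbabilityMeasure (volume.restrict (Set.Ioo (0 : ℝ) 1)) := ⟨by simp⟩
  exact Measure.isProbabilityMeasure_map measurable_up.aemeasurable

theorem measurable_clampIoo_down : Measurable fun ω : ULift.{u} ℝ => clampIoo ω.down :=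
  measurable_clampIoo.comp measurable_down

theorem uniformULift_real_clampIoo_le {w : ℝ} (hw : w ∈ Set.Ioo (0 : ℝ) 1) :
    uniformULift.{u}.real {ω | clampIoo ω.down ≤ w} = w := by
  have hs : MeasurableSet {x | clampIoo x ≤ w} :=
    measurableSet_le measurable_clampIoo measurable_const
  have heq : {x | clampIoo x ≤ w} ∩ Set.Ioo 0 1 = Set.Ioc 0 w := by
    ext x
    simp only [Set.mem_inter_iff, Set.mem_ofPred_eq, Set.mem_Ioc, clampIoo]
    constructor
    · rintro ⟨h, hx⟩
      rw [if_pos hx] at h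
      exact ⟨hx.1, h⟩
    · rintro ⟨h, hx⟩
      have hx' : x ∈ Set.Ioo (0 : ℝ) 1 := ⟨h, hx.trans_lt hw.2⟩
      rw [if_pos hx']
      exact ⟨hx, hx'⟩
  rw [uniformULift, map_measureReal_apply measurable_up
    (measurableSet_le measurable_clampIoo_down measurable_const)]
  rw [show (ULift.up ⁻¹' {ω : ULift.{u} ℝ | clampIoo ω.down ≤ w}) = {x | clampIoo x ≤ w} from rfl,
    measureReal_restrict_apply hs, heq, Real.volume_real_Ioc_of_le hw.1.le, sub_zero]

theorem exists_expectedMax_eq {μ : ℕ → ℝ}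
    (h1 : ∀ s k : ℕ, 1 ≤ s → 1 ≤ k → 0 < (-1 : ℝ) ^ (s + 1) * (fwdDiff 1)^[s] μ k)
    (h2 : Asymptotics.IsLittleO atTop μ (fun k : ℕ => (k : ℝ)))
    (h3 : Asymptotics.IsLittleO atTop
      (fun k : ℕ => ∑ j ∈ Finset.Icc 1 k, (-1 : ℝ) ^ j * (k.choose j : ℝ) * μ j)
      (fun k : ℕ => (k : ℝ))) :
    ∃ X : ULift.{u} ℝ → ℝ, Measurable X ∧ Integrable X uniformULift ∧
      ∀ k : ℕ, 1 ≤ k → expectedMax uniformULift X k = μ k := by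
  obtain ⟨m, hfin, hm, hmom⟩ := exists_measure_Ioo_moments h1 h2 h3
  let l : Measure ℝ := m.withDensity fun w => betaDensity w
  -- Clamping makes the layer integrable for every `ω`, not just almost every one.
  let V : ULift.{u} ℝ → ℝ := fun ω => clampIoo ω.down
  have hV : Measurable V := measurable_clampIoo_down
  have hl (ω : ULift.{u} ℝ) : Integrable (layer (1 / 2) (V ω)) l :=
    integrable_layer_withDensity_betaDensity hm (by norm_num) (clampIoo_mem _)
  have hF : Integrable (fun w => (if 1 / 2 ≤ w then 1 else 0) -
      uniformULift.{u}.real {ω | V ω ≤ w}) l := by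
    -- Splitting at `1/2` leaves `1 - w` where `w ≥ 1/2` and `w` where `w < 1/2`; both are at most
    -- `2 * (w * (1 - w))`.
    refine integrable_withDensity_betaDensity hm (C := 2)
      ((Measurable.ite measurableSet_Ici measurable_const measurable_const).sub
        (measurable_measureReal_le V)) fun w hw => ?_
    rw [uniformULift_real_clampIoo_le hw]
    obtain ⟨hw0, hw1⟩ := hw
    split_ifs with h
    · rw [abs_of_nonneg (by linarith)]
      nlinarith
    · rw [zero_sub, abs_neg, abs_of_pos hw0]
      nlinarith
  have hae : ∀ᵐ w ∂l, w ∈ Set.Ioo (0 : ℝ) 1 := (withDensity_absolutelyContinuous _ _).ae_le hm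
  let G : ULift.{u} ℝ → ℝ := fun ω => ∫ w, layer (1 / 2) (V ω) w ∂l
  -- The shift fixes the mean; all later values are then determined by increments.
  let d : ℝ := μ 1 - ∫ w, ((if 1 / 2 ≤ w then 1 else 0) -
    uniformULift.{u}.real {ω | V ω ≤ w} ^ 1) ∂l
  have hE {k : ℕ} (hk : 1 ≤ k) := expectedMax_integral_layer hV hl hF d hk
  have hG : Measurable G := by
    have h : StronglyMeasurable fun p : ULift.{u} ℝ × ℝ => layer (1 / 2) (V p.1) p.2 :=
      (measurable_layer_comp_uncurry hV (1 / 2)).stronglyMeasurable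
    exact h.integral_prod_right.measurable
  refine ⟨fun ω => G ω + d, hG.add_const d,
    (integrable_and_integral_integral_layer hV (1 / 2) hF).1.add (integrable_const d), ?_⟩
  intro k hk
  induction k, hk using Nat.le_induction with
  | base => rw [hE le_rfl, add_sub_cancel]
  | succ k hk ih =>
    have hstep : expectedMax uniformULift (fun ω => G ω + d) (k + 1) -
        expectedMax uniformULift (fun ω => G ω + d) k = μ (k + 1) - μ k := by
      obtain ⟨k, rfl⟩ := Nat.exists_eq_add_of_le' hk
      rw [hE (by omega), hE (by omega), add_sub_add_right_eq_sub, ← integral_sub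
        (integrable_step_sub_cdf_pow hF (by omega)) (integrable_step_sub_cdf_pow hF (by omega)),
        ← hmom k, ← integral_withDensity_betaDensity hm k]
      refine integral_congr_ae ?_
      filter_upwards [hae] with w hw
      rw [uniformULift_real_clampIoo_le hw]
      ring
    linarith

/-- The sequence is `μ 1, μ 2, …`; the value `μ 0` plays no role. -/
theorem theorem1p2 (μ : ℕ → ℝ) :
    (∃ (Ω : Type u) (_ : MeasurableSpace Ω) (P : Measure Ω) (X : Ω → ℝ),
        IsProbabilityMeasure P ∧ Measurable X ∧ Integrable X P ∧ ¬ IsDegenerate P X ∧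
        ∀ k : ℕ, 1 ≤ k → expectedMax P X k = μ k) ↔
      ((∀ s k : ℕ, 1 ≤ s → 1 ≤ k → 0 < (-1 : ℝ) ^ (s + 1) * (fwdDiff 1)^[s] μ k) ∧
        Asymptotics.IsLittleO Filter.atTop μ (fun k : ℕ => (k : ℝ)) ∧
        Asymptotics.IsLittleO Filter.atTop
          (fun k : ℕ => ∑ j ∈ Finset.Icc 1 k, (-1 : ℝ) ^ j * (k.choose j : ℝ) * μ j)
          (fun k : ℕ => (k : ℝ))) := by
  constructor
  · rintro ⟨Ω, _, P, X, _, hX, hint, hdeg, hμ⟩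
    exact ⟨fun s k hs hk => fwdDiff_pos_of_expectedMax hX hint hdeg hμ hs hk,
      isLittleO_of_expectedMax hX hint hμ, isLittleO_sum_of_expectedMax hX hint hμ⟩
  · rintro ⟨h1, h2, h3⟩
    obtain ⟨X, hX, hint, hμ⟩ := exists_expectedMax_eq.{u} h1 h2 h3
    refine ⟨ULift.{u} ℝ, inferInstance, uniformULift, X, inferInstance, hX, hint, ?_, hμ⟩
    -- A constant variable would give `μ 2 = μ 1`, against (i) at `s = k = 1`.
    rintro ⟨c, hc⟩
    have h := h1 1 1 le_rfl le_rfl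
    rw [Function.iterate_one, fwdDiff, ← hμ 1 le_rfl, ← hμ (1 + 1) (by omega),
      expectedMax_eq_of_ae_eq_const hc le_rfl, expectedMax_eq_of_ae_eq_const hc (by omega)] at h
    simp at h
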